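/- Let $n\ge 0$ and let $P=\{p_1,\dots,p_n\}$ be a set of propositional variables. For a poset $X$ let $\mathcal U(X)$ be the Heyting algebra of up-sets of $X$ ordered by inclusion, with $U\to V=\{x : \text{for all } y\ge x,\ y\in U \text{ implies } y\in V\}$. A (Kripke) model is a poset $M$ with an order-preserving map $c:M\to 2^n$; write $v(p_i)=\{x\in M : c(x)_i=1\}\in\mathcal U(M)$. A point is a $p$-border point if it is a maximal element of the complement of $v(p)$, and it is separated if it is a $p$-border point for some $p\in P$. The model $M$ has borders if for every $p\in P$ and every $x\notin v(p)$ there is a $p$-border point $u\ge x$. A p-morphism between models is an order-preserving map $f:M\to N$ with $c_N\circ f=c_M$ such that whenever $f(x)\le y$ there is $x'\ge x$ with $f(x')=y$. Let $F_{HA}(n)$ be the Lindenbaum algebra of intuitionistic propositional logic over $P$ (the free Heyting algebra on $n$ generators). The universal model $U(n)$ consists of those proper prime filters $x$ of $F_{HA}(n)$ for which there are only finitely many prime filters containing $x$; it is ordered by inclusion and coloured by $c(x)_i=1$ iff $p_i\in x$. Let $M$ be a model with borders, and let $M^s$ be the set of separated points of $M$ with the induced order and colouring. Then there is a unique p-morphism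 $f:M^s\to U(n)$. Let $M_{\wedge,\to}=\mathrm{im}(f)$, with the order induced from $U(n)$, let $h:\mathcal U(M_{\wedge,\to})\to\mathcal U(M^s)$, $h(U)=f^{-1}(U)$, and let $r:\mathcal U(M^s)\to\mathcal U(M)$, $r(V)=\{x\in M : \text{for all } y\in M^s,\ y\ge x \text{ implies } y\in V\}$, which is the upper adjoint of the restriction map $U\mapsto U\cap M^s$. Let $B$ be the $(\wedge,\to)$-subalgebra of $\mathcal U(M)$ generated by $v(p_1),\dots,v(p_n)$, i.e. the smallest nonempty subset containing these elements and closed under $\wedge$ and $\to$. Then $B$ is equal to the image of the composite $r\circ h$. In particular, $B$ is isomorphic, as an implicative meet-semilattice, to $\mathcal U(M_{\wedge,\to})$. -/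

import Mathlib

namespace MeetImp

universe u v

/-! ### The Heyting algebra of up-sets -/

/-- An up-set (upward closed subset) of a poset. -/
@[ext]
structure UpSet (X : Type u) [PartialOrder X] where
  carrier : Set X
  upper : IsUpperSet carrier

namespace UpSet

instance {X : Type u} [PartialOrder X] : SetLike (UpSet X) X where
  coe := UpSet.carrier
  coe_injective := fun _ _ h => UpSet.ext h

/-- Up-sets are ordered by inclusion. -/
instance {X : Type u} [PartialOrder X] : PartialOrder (UpSet X) := .ofSetLike (UpSet X) X

/-- The Heyting algebra `𝒰(X)`: meet is intersection, join is union, and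
`U ⇨ V = {x | ∀ y ≥ x, y ∈ U → y ∈ V}`. -/
instance {X : Type u} [PartialOrder X] : HeytingAlgebra (UpSet X) where
  inf U V := ⟨U.carrier ∩ V.carrier, U.upper.inter V.upper⟩
  sup U V := ⟨U.carrier ∪ V.carrier, U.upper.union V.upper⟩
  top := ⟨Set.univ, isUpperSet_univ⟩
  bot := ⟨∅, isUpperSet_empty⟩
  himp U V := ⟨{x | ∀ y, x ≤ y → y ∈ U.carrier → y ∈ V.carrier},
    fun _ _ hab ha y hby hy => ha y (hab.trans hby) hy⟩
  compl U := ⟨{x | ∀ y, x ≤ y → y ∉ U.carrier}, fun _ _ hab ha y hby => ha y (hab.trans hby)⟩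
  inf_le_left _ _ := fun _ hx => hx.1
  inf_le_right _ _ := fun _ hx => hx.2
  le_inf _ _ _ h₁ h₂ := fun _ hx => ⟨h₁ hx, h₂ hx⟩
  le_sup_left _ _ := fun _ hx => Or.inl hx
  le_sup_right _ _ := fun _ hx => Or.inr hx
  sup_le _ _ _ h₁ h₂ := fun _ hx => hx.elim (fun h => h₁ h) (fun h => h₂ h)
  le_top _ := fun _ _ => trivial
  bot_le _ := fun _ hx => hx.elim
  le_himp_iff U _ _ := ⟨fun h x hx => h hx.1 x le_rfl hx.2,
    fun h _ hx _ hxy hy => h ⟨U.upper hxy hx, hy⟩⟩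
  himp_bot _ := rfl

/-- The dual of a monotone map: `U ↦ g⁻¹(U)`. -/
def preimage {X : Type u} {Y : Type v} [PartialOrder X] [PartialOrder Y] (g : X →o Y)
    (U : UpSet Y) : UpSet X :=
  ⟨g ⁻¹' U.carrier, U.upper.preimage g.monotone⟩

end UpSet

/-! ### `(∧,→)`-subalgebras and `(∧,→)`-isomorphisms -/

/-- A subalgebra of the implicative meet-semilattice underlying a Heyting algebra: a nonempty
subset closed under `∧` and `→`. -/
structure Subalg (A : Type u) [HeytingAlgebra A] where
  carrier : Set A
  nonempty : carrier.Nonempty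
  inf_mem : ∀ {a b : A}, a ∈ carrier → b ∈ carrier → a ⊓ b ∈ carrier
  himp_mem : ∀ {a b : A}, a ∈ carrier → b ∈ carrier → a ⇨ b ∈ carrier

namespace Subalg

/-- Every `(∧,→)`-subalgebra contains the top element. -/
theorem top_mem {A : Type u} [HeytingAlgebra A] (B : Subalg A) : ⊤ ∈ B.carrier := by
  obtain ⟨a, ha⟩ := B.nonempty
  simpa using B.himp_mem ha ha

instance {A : Type u} [HeytingAlgebra A] (B : Subalg A) : Min B.carrier :=
  ⟨fun a b => ⟨a.1 ⊓ b.1, B.inf_mem a.2 b.2⟩⟩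

instance {A : Type u} [HeytingAlgebra A] (B : Subalg A) : HImp B.carrier :=
  ⟨fun a b => ⟨a.1 ⇨ b.1, B.himp_mem a.2 b.2⟩⟩

/-- The `(∧,→)`-subalgebra generated by a set: the intersection of all subalgebras
containing it. -/
def generate {A : Type u} [HeytingAlgebra A] (S : Set A) : Subalg A where
  carrier := {a | ∀ B : Subalg A, S ⊆ B.carrier → a ∈ B.carrier}
  nonempty := ⟨⊤, fun B _ => B.top_mem⟩
  inf_mem ha hb := fun B hB => B.inf_mem (ha B hB) (hb B hB)
  himp_mem ha hb := fun B hB => B.himp_mem (ha B hB) (hb B hB)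

end Subalg

/-- An isomorphism of implicative meet-semilattices `(A,∧,→) ≅ (B,∧,→)`. -/
structure Iso (A : Type u) (B : Type v) [Min A] [HImp A] [Min B] [HImp B] extends A ≃ B where
  map_inf' : ∀ a b : A, toFun (a ⊓ b) = toFun a ⊓ toFun b
  map_himp' : ∀ a b : A, toFun (a ⇨ b) = toFun a ⇨ toFun b

/-! ### Intuitionistic propositional logic and its Lindenbaum algebra -/

/-- Propositional formulas in the variables `p_1, …, p_n`. -/
inductive Formula (n : ℕ) : Type
  | var : Fin n → Formula n
  | bot : Formula n
  | and : Formula n → Formula n → Formula n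
  | or : Formula n → Formula n → Formula n
  | imp : Formula n → Formula n → Formula n

/-- Natural deduction for IPC: `Prf Γ φ` means that `φ` is derivable from hypotheses in `Γ`. -/
inductive Prf {n : ℕ} : Set (Formula n) → Formula n → Prop
  | ax {Γ φ} : φ ∈ Γ → Prf Γ φ
  | botE {Γ φ} : Prf Γ .bot → Prf Γ φ
  | andI {Γ φ ψ} : Prf Γ φ → Prf Γ ψ → Prf Γ (.and φ ψ)
  | andE₁ {Γ φ ψ} : Prf Γ (.and φ ψ) → Prf Γ φ
  | andE₂ {Γ φ ψ} : Prf Γ (.and φ ψ) → Prf Γ ψ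
  | orI₁ {Γ φ ψ} : Prf Γ φ → Prf Γ (.or φ ψ)
  | orI₂ {Γ φ ψ} : Prf Γ ψ → Prf Γ (.or φ ψ)
  | orE {Γ φ ψ χ} : Prf Γ (.or φ ψ) → Prf (insert φ Γ) χ → Prf (insert ψ Γ) χ → Prf Γ χ
  | impI {Γ φ ψ} : Prf (insert φ Γ) ψ → Prf Γ (.imp φ ψ)
  | impE {Γ φ ψ} : Prf Γ (.imp φ ψ) → Prf Γ φ → Prf Γ ψ

theorem Prf.weaken {n : ℕ} {Γ Δ : Set (Formula n)} {φ : Formula n} (h : Prf Γ φ) (hs : Γ ⊆ Δ) :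
    Prf Δ φ := by
  induction h generalizing Δ with
  | ax h => exact .ax (hs h)
  | botE _ ih => exact .botE (ih hs)
  | andI _ _ ih₁ ih₂ => exact .andI (ih₁ hs) (ih₂ hs)
  | andE₁ _ ih => exact .andE₁ (ih hs)
  | andE₂ _ ih => exact .andE₂ (ih hs)
  | orI₁ _ ih => exact .orI₁ (ih hs)
  | orI₂ _ ih => exact .orI₂ (ih hs)
  | orE _ _ _ ih ih₁ ih₂ =>
    exact .orE (ih hs) (ih₁ (Set.insert_subset_insert hs)) (ih₂ (Set.insert_subset_insert hs))
  | impI _ ih => exact .impI (ih (Set.insert_subset_insert hs))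
  | impE _ _ ih₁ ih₂ => exact .impE (ih₁ hs) (ih₂ hs)

namespace Formula

/-- `φ ≼ ψ` when `ψ` is provable from `φ` in IPC. -/
def Entails {n : ℕ} (φ ψ : Formula n) : Prop := Prf {φ} ψ

theorem Entails.refl {n : ℕ} (φ : Formula n) : φ.Entails φ := .ax rfl

theorem Entails.cut {n : ℕ} {Γ : Set (Formula n)} {φ ψ : Formula n} (h₂ : φ.Entails ψ)
    (h₁ : Prf Γ φ) : Prf Γ ψ :=
  .impE (.impI (h₂.weaken (by simp))) h₁

theorem Entails.trans {n : ℕ} {φ ψ χ : Formula n} (h₁ : φ.Entails ψ) (h₂ : ψ.Entails χ) :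
    φ.Entails χ := h₂.cut h₁

theorem Entails.and_intro {n : ℕ} {φ ψ χ : Formula n} (h₁ : φ.Entails ψ) (h₂ : φ.Entails χ) :
    φ.Entails (.and ψ χ) := .andI h₁ h₂

theorem Entails.and_left {n : ℕ} (φ ψ : Formula n) : (and φ ψ).Entails φ := .andE₁ (.ax rfl)

theorem Entails.and_right {n : ℕ} (φ ψ : Formula n) : (and φ ψ).Entails ψ := .andE₂ (.ax rfl)

theorem Entails.or_left {n : ℕ} (φ ψ : Formula n) : φ.Entails (or φ ψ) := .orI₁ (.ax rfl)

theorem Entails.or_right {n : ℕ} (φ ψ : Formula n) : ψ.Entails (or φ ψ) := .orI₂ (.ax rfl)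

theorem Entails.or_elim {n : ℕ} {φ ψ χ : Formula n} (h₁ : φ.Entails χ) (h₂ : ψ.Entails χ) :
    (or φ ψ).Entails χ :=
  .orE (.ax rfl) (h₁.weaken (by simp)) (h₂.weaken (by simp))

theorem entails_imp_iff {n : ℕ} {φ ψ χ : Formula n} :
    φ.Entails (imp ψ χ) ↔ (and φ ψ).Entails χ := by
  constructor
  · intro h
    exact .impE (h.cut (.andE₁ (.ax rfl))) (.andE₂ (.ax rfl))
  · intro h
    exact .impI (h.cut (.andI (.ax (by simp)) (.ax (by simp))))

theorem Entails.imp_mono {n : ℕ} {φ φ' ψ ψ' : Formula n} (h₁ : φ'.Entails φ)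
    (h₂ : ψ.Entails ψ') : (imp φ ψ).Entails (imp φ' ψ') :=
  .impI (h₂.cut (.impE (.ax (by simp)) (h₁.cut (.ax (by simp)))))

/-- Provable equivalence in IPC. -/
instance equiv (n : ℕ) : Setoid (Formula n) where
  r φ ψ := φ.Entails ψ ∧ ψ.Entails φ
  iseqv := ⟨fun φ => ⟨.refl φ, .refl φ⟩, fun h => ⟨h.2, h.1⟩,
    fun h₁ h₂ => ⟨h₁.1.trans h₂.1, h₂.2.trans h₁.2⟩⟩

/-- The value of a formula in a Heyting algebra, under an assignment of the variables. -/
def eval {n : ℕ} {A : Type u} [HeytingAlgebra A] (a : Fin n → A) : Formula n → A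
  | var i => a i
  | bot => ⊥
  | and φ ψ => eval a φ ⊓ eval a ψ
  | or φ ψ => eval a φ ⊔ eval a ψ
  | imp φ ψ => eval a φ ⇨ eval a ψ

end Formula

/-- The Lindenbaum algebra of IPC in `n` variables, i.e. the free Heyting algebra on `n`
generators. -/
def FreeHA (n : ℕ) : Type := Quotient (Formula.equiv n)

namespace FreeHA

/-- The class of a formula. -/
def mk {n : ℕ} (φ : Formula n) : FreeHA n := Quotient.mk (Formula.equiv n) φ

instance (n : ℕ) : HeytingAlgebra (FreeHA n) where
  le := Quotient.lift₂ Formula.Entails fun _ _ _ _ h₁ h₂ => propext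
    ⟨fun h => (h₁.2.trans h).trans h₂.1, fun h => (h₁.1.trans h).trans h₂.2⟩
  le_refl := by
    rintro ⟨φ⟩
    exact Formula.Entails.refl φ
  le_trans := by
    rintro ⟨φ⟩ ⟨ψ⟩ ⟨χ⟩ h₁ h₂
    exact Formula.Entails.trans h₁ h₂
  le_antisymm := by
    rintro ⟨φ⟩ ⟨ψ⟩ h₁ h₂
    exact Quotient.sound ⟨h₁, h₂⟩
  inf := Quotient.map₂ Formula.and fun _ _ h₁ _ _ h₂ =>
    ⟨.and_intro ((Formula.Entails.and_left _ _).trans h₁.1)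
        ((Formula.Entails.and_right _ _).trans h₂.1),
      .and_intro ((Formula.Entails.and_left _ _).trans h₁.2)
        ((Formula.Entails.and_right _ _).trans h₂.2)⟩
  sup := Quotient.map₂ Formula.or fun _ _ h₁ _ _ h₂ =>
    ⟨.or_elim (h₁.1.trans (Formula.Entails.or_left _ _))
        (h₂.1.trans (Formula.Entails.or_right _ _)),
      .or_elim (h₁.2.trans (Formula.Entails.or_left _ _))
        (h₂.2.trans (Formula.Entails.or_right _ _))⟩
  himp := Quotient.map₂ Formula.imp fun _ _ h₁ _ _ h₂ =>
    ⟨.imp_mono h₁.2 h₂.1, .imp_mono h₁.1 h₂.2⟩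
  compl := Quotient.map (fun φ => Formula.imp φ .bot) fun _ _ h =>
    ⟨.imp_mono h.2 (.refl _), .imp_mono h.1 (.refl _)⟩
  top := mk (.imp .bot .bot)
  bot := mk .bot
  inf_le_left := by
    rintro ⟨φ⟩ ⟨ψ⟩
    exact Formula.Entails.and_left φ ψ
  inf_le_right := by
    rintro ⟨φ⟩ ⟨ψ⟩
    exact Formula.Entails.and_right φ ψ
  le_inf := by
    rintro ⟨φ⟩ ⟨ψ⟩ ⟨χ⟩ h₁ h₂
    exact Formula.Entails.and_intro h₁ h₂
  le_sup_left := by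
    rintro ⟨φ⟩ ⟨ψ⟩
    exact Formula.Entails.or_left φ ψ
  le_sup_right := by
    rintro ⟨φ⟩ ⟨ψ⟩
    exact Formula.Entails.or_right φ ψ
  sup_le := by
    rintro ⟨φ⟩ ⟨ψ⟩ ⟨χ⟩ h₁ h₂
    exact Formula.Entails.or_elim h₁ h₂
  le_top := by
    rintro ⟨φ⟩
    exact Prf.impI (.ax (by simp))
  bot_le := by
    rintro ⟨φ⟩
    exact Prf.botE (.ax rfl)
  le_himp_iff := by
    rintro ⟨φ⟩ ⟨ψ⟩ ⟨χ⟩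
    exact Formula.entails_imp_iff
  himp_bot := by
    rintro ⟨φ⟩
    rfl

end FreeHA

/-! ### Kripke models -/

/-- A colouring of a poset `X`: an order-preserving map to `2^n`, where `2` is the poset of
truth values. A poset together with a colouring is a Kripke model on `n` variables. -/
abbrev Colouring (n : ℕ) (X : Type u) [PartialOrder X] := X →o (Fin n → Prop)

/-- The value `v(φ)` of a formula in a Kripke model, where
`v(p_i)` is the set of points whose colour has `i`-th coordinate `1`. -/
def val {n : ℕ} {X : Type u} [PartialOrder X] (c : Colouring n X) : Formula n → UpSet X :=
  Formula.eval fun i => ⟨{x | c x i}, fun _ _ hxy hx => c.monotone hxy i hx⟩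

/-- `x` is a border point of the up-set `U`: a maximal element of its complement. -/
def IsBorderPoint {X : Type u} [PartialOrder X] (U : UpSet X) (x : X) : Prop :=
  Maximal (fun y => y ∉ U) x

/-- A model has borders if, for each variable `p`, above each point outside `v(p)` there is a
border point of `v(p)`. -/
def HasBorders {n : ℕ} {X : Type u} [PartialOrder X] (c : Colouring n X) : Prop :=
  ∀ (i : Fin n) (x : X), x ∉ val c (.var i) → ∃ u, x ≤ u ∧ IsBorderPoint (val c (.var i)) u

/-- A point is separated if it is a border point of `v(p)` for some variable `p`. -/
def IsSeparated {n : ℕ} {X : Type u} [PartialOrder X] (c : Colouring n X) (x : X) : Prop :=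
  ∃ i : Fin n, IsBorderPoint (val c (.var i)) x

/-- The submodel `M^s` of separated points, with the induced order. -/
abbrev Sep {n : ℕ} {X : Type u} [PartialOrder X] (c : Colouring n X) : Type u :=
  {x : X // IsSeparated c x}

/-- The inclusion of `M^s` in `M`. -/
def Sep.incl {n : ℕ} {X : Type u} [PartialOrder X] (c : Colouring n X) : Sep c →o X :=
  ⟨Subtype.val, fun _ _ h => h⟩

/-- The colouring of `M^s`, which is the restriction of the one of `M`. -/
def Sep.colouring {n : ℕ} {X : Type u} [PartialOrder X] (c : Colouring n X) :
    Colouring n (Sep c) :=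
  c.comp (Sep.incl c)

/-- A p-morphism between Kripke models. -/
structure PMorphism {n : ℕ} {X : Type u} {Y : Type v} [PartialOrder X] [PartialOrder Y]
    (c : Colouring n X) (d : Colouring n Y) extends X →o Y where
  back : ∀ x y, toFun x ≤ y → ∃ x', x ≤ x' ∧ toFun x' = y
  colour : ∀ x, d (toFun x) = c x

/-! ### The canonical model and the universal model -/

/-- The dual poset of a lattice: its (proper) prime filters, ordered by inclusion. -/
abbrev DualPoset (D : Type u) [Lattice D] : Type u := {F : Order.PFilter D // F.IsPrime}

/-- The canonical frame `C(n)`. -/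
abbrev Canonical (n : ℕ) : Type := DualPoset (FreeHA n)

/-- The colouring of the canonical model: `p_i` holds at `x` iff `p_i ∈ x`. -/
def Canonical.colouring (n : ℕ) : Colouring n (Canonical n) :=
  ⟨fun x i => FreeHA.mk (.var i) ∈ x.1, fun _ _ hxy _ h => hxy h⟩

/-- The universal model `U(n)`: the image-finite part of the canonical model. -/
abbrev Universal (n : ℕ) : Type := {x : Canonical n // (Set.Ici x).Finite}

/-- The colouring of the universal model. -/
def Universal.colouring (n : ℕ) : Colouring n (Universal n) :=
  (Canonical.colouring n).comp ⟨Subtype.val, fun _ _ h => h⟩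

/-! ### The maps `q`, `r`, `h` -/

/-- The restriction map `q : 𝒰(M) → 𝒰(M^s)`, dual to the inclusion. -/
def qMap {n : ℕ} {X : Type u} [PartialOrder X] (c : Colouring n X) : UpSet X → UpSet (Sep c) :=
  UpSet.preimage (Sep.incl c)

/-- The map `r : 𝒰(M^s) → 𝒰(M)`, the upper adjoint of `q`. -/
def rMap {n : ℕ} {X : Type u} [PartialOrder X] (c : Colouring n X) (V : UpSet (Sep c)) :
    UpSet X :=
  ⟨{x | ∀ y : Sep c, x ≤ y.1 → y ∈ V}, fun _ _ hab ha y hy => ha y (hab.trans hy)⟩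

theorem gc_qMap_rMap {n : ℕ} {X : Type u} [PartialOrder X] (c : Colouring n X) :
    GaloisConnection (qMap c) (rMap c) :=
  fun U _ => ⟨fun h _ hx y hxy => h (show y.1 ∈ U from U.upper hxy hx),
    fun h y hy => h (show y.1 ∈ U from hy) y le_rfl⟩

/-- The image of a p-morphism, with the order induced from the codomain. -/
abbrev PMorphism.Im {n : ℕ} {X : Type u} {Y : Type v} [PartialOrder X] [PartialOrder Y]
    {c : Colouring n X} {d : Colouring n Y} (f : PMorphism c d) : Type v :=
  {y : Y // y ∈ Set.range f.toFun}

/-- The surjection of a p-morphism onto its image. -/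
def PMorphism.toIm {n : ℕ} {X : Type u} {Y : Type v} [PartialOrder X] [PartialOrder Y]
    {c : Colouring n X} {d : Colouring n Y} (f : PMorphism c d) : X →o f.Im :=
  ⟨fun x => ⟨f.toFun x, x, rfl⟩, fun _ _ h => f.monotone' h⟩

/-- The map `h : 𝒰(im f) → 𝒰(M)` dual to the surjection of `f` onto its image. -/
def PMorphism.hMap {n : ℕ} {X : Type u} {Y : Type v} [PartialOrder X] [PartialOrder Y]
    {c : Colouring n X} {d : Colouring n Y} (f : PMorphism c d) : UpSet f.Im → UpSet X :=
  UpSet.preimage f.toIm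

end MeetImp

open MeetImp

/-!
Along the strict order of `M^s` the set of true variables grows, because a strict successor of a
border point of `v(p)` satisfies `p`. The theory of a point is determined by its colour and the
theories of its strict successors (`theory_eq_of_image_Ioi_eq`), so by induction on colours only
finitely many theories are realised in `M^s`, although `M^s` itself may be infinite
(`finite_range_theory`). A prime filter extending the theory of `x` is then itself the theory of a
point above `x`: otherwise one implication true at `x` would separate it from these finitely many
theories (`exists_theory_eq`). Hence `x ↦ theory x` is a p-morphism into the universal model, and it
is the only one, since p-morphisms preserve truth and a point of the universal model satisfies
exactly the formulas it contains (`Universal.mem_val_iff`).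

The maps `h` and `r` are injective and preserve `∧` and `→`, and `r ∘ h` sends `v(p)` to `v(p)`
because `M` has borders. So `B` is the image under `r ∘ h` of the subalgebra of `𝒰(im f)` generated
by the variables, and it remains to see that the latter is all of `𝒰(im f)`. Here `im f` is a finite
model in which all points are separated and are determined by their colours and strict successors.
By induction from the largest colours, the complement of each principal down-set `↓w` is generated:
it is `V → v(p)`, with `w` a border point of `v(p)` and `V` the least generated up-set containing `w`
(`notLE_mem_generate`). Every up-set is a finite intersection of such complements.
-/

namespace MeetImp

universe u v

/-! ### Up-sets and truth in a model -/

namespace UpSet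

variable {X : Type u} [PartialOrder X] {U V : UpSet X} {x : X}

theorem mem_of_le (U : UpSet X) {x y : X} (hxy : x ≤ y) (hx : x ∈ U) : y ∈ U := U.upper hxy hx

theorem mem_inf : x ∈ U ⊓ V ↔ x ∈ U ∧ x ∈ V := Iff.rfl

theorem mem_himp : x ∈ U ⇨ V ↔ ∀ y, x ≤ y → y ∈ U → y ∈ V := Iff.rfl

theorem mem_top : x ∈ (⊤ : UpSet X) := trivial

theorem mem_himp_iff : x ∈ U ⇨ V ↔ (x ∈ U → x ∈ V) ∧ ∀ y, x < y → y ∈ U → y ∈ V := by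
  refine mem_himp.trans ⟨fun h => ⟨h x le_rfl, fun y hy => h y hy.le⟩, fun h y hxy => ?_⟩
  rcases hxy.eq_or_lt with rfl | hlt
  exacts [h.1, h.2 y hlt]

end UpSet

section Truth

variable {n : ℕ} {X : Type u} {Y : Type v} [PartialOrder X] [PartialOrder Y]
  {c : Colouring n X} {d : Colouring n Y}

theorem mem_val_var {i : Fin n} {x : X} : x ∈ val c (.var i) ↔ c x i := Iff.rfl

theorem notMem_val_bot {x : X} : x ∉ val c .bot := fun h => h

theorem mem_val_and {φ ψ : Formula n} {x : X} :
    x ∈ val c (.and φ ψ) ↔ x ∈ val c φ ∧ x ∈ val c ψ := Iff.rfl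

theorem mem_val_or {φ ψ : Formula n} {x : X} :
    x ∈ val c (.or φ ψ) ↔ x ∈ val c φ ∨ x ∈ val c ψ := Iff.rfl

theorem val_imp (φ ψ : Formula n) : val c (.imp φ ψ) = val c φ ⇨ val c ψ := rfl

theorem mem_val_imp {φ ψ : Formula n} {x : X} :
    x ∈ val c (.imp φ ψ) ↔ ∀ y, x ≤ y → y ∈ val c φ → y ∈ val c ψ := Iff.rfl

/-- Soundness of natural deduction for Kripke models. -/
theorem Prf.sound {Γ : Set (Formula n)} {φ : Formula n} (h : Prf Γ φ) (x : X)
    (hx : ∀ γ ∈ Γ, x ∈ val c γ) : x ∈ val c φ := by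
  induction h generalizing x with
  | ax h => exact hx _ h
  | botE _ ih => exact (notMem_val_bot (ih x hx)).elim
  | andI _ _ ih₁ ih₂ => exact ⟨ih₁ x hx, ih₂ x hx⟩
  | andE₁ _ ih => exact (ih x hx).1
  | andE₂ _ ih => exact (ih x hx).2
  | orI₁ _ ih => exact Or.inl (ih x hx)
  | orI₂ _ ih => exact Or.inr (ih x hx)
  | orE _ _ _ ih ih₁ ih₂ =>
    rcases ih x hx with h | h
    · exact ih₁ x (Set.forall_mem_insert.2 ⟨h, hx⟩)
    · exact ih₂ x (Set.forall_mem_insert.2 ⟨h, hx⟩)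
  | impI _ ih =>
    exact fun y hxy hy =>
      ih y (Set.forall_mem_insert.2 ⟨hy, fun γ hγ => UpSet.mem_of_le _ hxy (hx γ hγ)⟩)
  | impE _ _ ih₁ ih₂ => exact ih₁ x hx x le_rfl (ih₂ x hx)

/-- p-morphisms preserve and reflect the truth of formulas. -/
theorem PMorphism.mem_val_iff (f : PMorphism c d) (φ : Formula n) (x : X) :
    f.toFun x ∈ val d φ ↔ x ∈ val c φ := by
  induction φ generalizing x with
  | var i => rw [mem_val_var, mem_val_var, f.colour]
  | bot => exact Iff.rfl
  | and φ ψ ih₁ ih₂ => exact and_congr (ih₁ x) (ih₂ x)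
  | or φ ψ ih₁ ih₂ => exact or_congr (ih₁ x) (ih₂ x)
  | imp φ ψ ih₁ ih₂ =>
    rw [mem_val_imp, mem_val_imp]
    constructor
    · intro h y hxy hy
      exact (ih₂ y).1 (h _ (f.monotone' hxy) ((ih₁ y).2 hy))
    · intro h z hz hφ
      obtain ⟨y, hxy, rfl⟩ := f.back x z hz
      exact (ih₂ y).2 (h y hxy ((ih₁ y).1 hφ))

end Truth

/-! ### Prime filters -/

namespace DualPoset

variable {A : Type u}

section Lattice

variable [Lattice A] {F : DualPoset A} {a b : A}

theorem mem_of_le (hab : a ≤ b) (ha : a ∈ F.1) : b ∈ F.1 := Order.PFilter.mem_of_le hab ha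

theorem sup_mem_iff : a ⊔ b ∈ F.1 ↔ a ∈ F.1 ∨ b ∈ F.1 := by
  refine ⟨fun h => ?_, fun h => h.elim (mem_of_le le_sup_left) (mem_of_le le_sup_right)⟩
  by_contra! hab
  exact Order.Ideal.sup_mem (s := F.2.compl_ideal.toIdeal) hab.1 hab.2 h

theorem bot_notMem [OrderBot A] : (⊥ : A) ∉ F.1 := by
  obtain ⟨a, ha⟩ := F.2.compl_ideal.Nonempty
  exact fun h => ha (mem_of_le bot_le h)

/-- A subset satisfying the usual conditions is a prime filter. -/
def ofSet [BoundedOrder A] (S : Set A) (top_mem : ⊤ ∈ S) (bot_notMem : ⊥ ∉ S)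
    (mem_of_le : ∀ {a b : A}, a ≤ b → a ∈ S → b ∈ S)
    (inf_mem : ∀ {a b : A}, a ∈ S → b ∈ S → a ⊓ b ∈ S)
    (mem_or_mem : ∀ {a b : A}, a ⊔ b ∈ S → a ∈ S ∨ b ∈ S) : DualPoset A :=
  ⟨(Order.IsPFilter.of_def ⟨⊤, top_mem⟩
      (fun a ha b hb => ⟨a ⊓ b, inf_mem ha hb, inf_le_left, inf_le_right⟩) mem_of_le).toPFilter,
    ⟨⟨fun _ _ hba ha hb => ha (mem_of_le hba hb), ⟨⊥, bot_notMem⟩,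
      fun a ha b hb => ⟨a ⊔ b, fun h => (mem_or_mem h).elim ha hb, le_sup_left, le_sup_right⟩⟩⟩⟩

end Lattice

variable [HeytingAlgebra A] {F : DualPoset A} {a b : A}

theorem mem_of_himp_mem (h : a ⇨ b ∈ F.1) (ha : a ∈ F.1) : b ∈ F.1 :=
  mem_of_le himp_inf_le (Order.PFilter.inf_mem h ha)

/-- If `a ⇨ b` is not in the prime filter `F`, then the filter generated by `F` and `a` avoids
`b`, so it extends to a prime filter avoiding `b`. -/
theorem exists_ge_of_himp_notMem (h : a ⇨ b ∉ F.1) :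
    ∃ G : DualPoset A, F ≤ G ∧ a ∈ G.1 ∧ b ∉ G.1 := by
  have hF : Order.IsPFilter {x : A | a ⇨ x ∈ F.1} := by
    refine .of_def ⟨⊤, by simp⟩ ?_ ?_
    · intro x hx y hy
      refine ⟨x ⊓ y, ?_, inf_le_left, inf_le_right⟩
      rw [Set.mem_ofPred_eq, himp_inf_distrib]
      exact Order.PFilter.inf_mem hx hy
    · exact fun hxy hx => mem_of_le (himp_le_himp_left hxy) hx
  have hdisj : Disjoint (hF.toPFilter : Set A) (Order.Ideal.principal b : Set A) := by
    rw [Set.disjoint_left]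
    exact fun x hx hxb => h (mem_of_le (himp_le_himp_left hxb) hx)
  obtain ⟨J, hJ, hbJ, hFJ⟩ := DistribLattice.prime_ideal_of_disjoint_filter_ideal hdisj
  have hmem : ∀ x, x ∈ hJ.toPrimePair.F ↔ x ∉ J := fun x => Iff.rfl
  refine ⟨⟨hJ.toPrimePair.F, hJ.toPrimePair.F_isPrime⟩, fun x hx => ?_, ?_, ?_⟩
  · exact (hmem x).2 fun hxJ =>
      Set.disjoint_left.1 hFJ (show a ⇨ x ∈ F.1 from mem_of_le le_himp hx) hxJ
  · exact (hmem a).2 fun haJ =>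
      Set.disjoint_left.1 hFJ (show a ⇨ a ∈ F.1 by simp) haJ
  · exact fun hb => (hmem b).1 hb (hbJ (Order.Ideal.mem_principal_self))

/-- A prime filter `F` outside a finite set of prime filters is told apart from all of them by a
single implication: `a` is a meet of elements of `F`, and `b` a join of elements outside `F`. -/
theorem exists_separating {S : Set (DualPoset A)} (hS : S.Finite) (hF : F ∉ S) :
    ∃ a ∈ F.1, ∃ b ∉ F.1, ∀ G ∈ S, a ∈ G.1 → b ∈ G.1 := by
  induction S, hS using Set.Finite.induction_on with
  | empty => exact ⟨⊤, by simp, ⊥, bot_notMem, by simp⟩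
  | @insert G S _ _ ih =>
    obtain ⟨a, ha, b, hb, hab⟩ := ih fun h => hF (Set.mem_insert_of_mem _ h)
    by_cases hle : F.1 ≤ G.1
    · obtain ⟨e, heG, heF⟩ := SetLike.not_le_iff_exists.1 fun hge : G.1 ≤ F.1 =>
        hF (Set.mem_insert_iff.2 (.inl (Subtype.ext (le_antisymm hle hge))))
      refine ⟨a, ha, b ⊔ e, fun h => (sup_mem_iff.1 h).elim hb heF, ?_⟩
      exact Set.forall_mem_insert.2
        ⟨fun _ => mem_of_le le_sup_right heG, fun H hH h => mem_of_le le_sup_left (hab H hH h)⟩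
    · obtain ⟨e, heF, heG⟩ := SetLike.not_le_iff_exists.1 hle
      refine ⟨a ⊓ e, Order.PFilter.inf_mem ha heF, b, hb, ?_⟩
      exact Set.forall_mem_insert.2
        ⟨fun h => (heG (mem_of_le inf_le_right h)).elim,
          fun H hH h => hab H hH (mem_of_le inf_le_left h)⟩

theorem ext_mk {n : ℕ} {F G : Canonical n} (h : ∀ φ, FreeHA.mk φ ∈ F.1 ↔ FreeHA.mk φ ∈ G.1) :
    F = G :=
  Subtype.ext (SetLike.ext fun a => Quotient.inductionOn a h)

end DualPoset

/-- Truth lemma: the universal model, being an up-set of the canonical model, satisfies at a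
prime filter exactly the formulas whose classes belong to it. -/
theorem Universal.mem_val_iff {n : ℕ} (φ : Formula n) (x : Universal n) :
    x ∈ val (Universal.colouring n) φ ↔ FreeHA.mk φ ∈ x.1.1 := by
  induction φ generalizing x with
  | var i => exact Iff.rfl
  | bot => exact iff_of_false notMem_val_bot DualPoset.bot_notMem
  | and φ ψ ih₁ ih₂ =>
    rw [mem_val_and, ih₁, ih₂]
    exact Order.PFilter.inf_mem_iff.symm
  | or φ ψ ih₁ ih₂ =>
    rw [mem_val_or, ih₁, ih₂]
    exact DualPoset.sup_mem_iff.symm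
  | imp φ ψ ih₁ ih₂ =>
    rw [mem_val_imp]
    simp only [ih₁, ih₂]
    constructor
    · intro h
      by_contra hx
      obtain ⟨G, hxG, hφ, hψ⟩ := DualPoset.exists_ge_of_himp_notMem (F := x.1)
        (a := FreeHA.mk φ) (b := FreeHA.mk ψ) hx
      exact hψ (h ⟨G, x.2.subset (Set.Ici_subset_Ici.2 hxG)⟩ hxG hφ)
    · exact fun h y hxy => DualPoset.mem_of_himp_mem (hxy h)

/-! ### Theories of points -/

section Theory

variable {n : ℕ} {X : Type u} [PartialOrder X] (c : Colouring n X)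

/-- The point `x` satisfies the formulas of a class in the Lindenbaum algebra. -/
def Holds (x : X) : FreeHA n → Prop :=
  Quotient.lift (fun φ => x ∈ val c φ) fun _ _ h => propext
    ⟨fun hx => h.1.sound x (by simpa using hx), fun hx => h.2.sound x (by simpa using hx)⟩

/-- The theory of a point `x`: the prime filter of the (classes of) formulas true at `x`. -/
def theory (x : X) : Canonical n :=
  DualPoset.ofSet {a | Holds c x a} (fun _ _ h => h) (notMem_val_bot (c := c) (x := x))
    (by
      rintro ⟨φ⟩ ⟨ψ⟩ h hx
      exact Prf.sound (Γ := {φ}) h x fun γ hγ => Set.mem_singleton_iff.1 hγ ▸ hx)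
    (by
      rintro ⟨φ⟩ ⟨ψ⟩ h₁ h₂
      exact ⟨h₁, h₂⟩)
    (by
      rintro ⟨φ⟩ ⟨ψ⟩ h
      exact h)

variable {c}

theorem mk_mem_theory {x : X} {φ : Formula n} : FreeHA.mk φ ∈ (theory c x).1 ↔ x ∈ val c φ :=
  Iff.rfl

theorem theory_mono {x y : X} (hxy : x ≤ y) : theory c x ≤ theory c y := by
  rintro ⟨φ⟩ h
  exact UpSet.mem_of_le (val c φ) hxy h

/-- The only candidate for a p-morphism to the universal model sends a point to its theory. -/
theorem PMorphism.coe_eq_theory (f : PMorphism c (Universal.colouring n)) (x : X) :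
    (f.toFun x).1 = theory c x :=
  DualPoset.ext_mk fun φ => by
    rw [← Universal.mem_val_iff, f.mem_val_iff, mk_mem_theory]

/-- The theory of a point is determined by its colour and the theories of its strict
successors. -/
theorem theory_eq_of_image_Ioi_eq {x y : X} (hc : c x = c y)
    (hs : theory c '' Set.Ioi x = theory c '' Set.Ioi y) : theory c x = theory c y := by
  -- The strict successors of a point enter the truth condition of `φ → ψ` only via their theories.
  have key (φ ψ : Formula n) (z : X) : (∀ w, z < w → w ∈ val c φ → w ∈ val c ψ) ↔
      ∀ T ∈ theory c '' Set.Ioi z, FreeHA.mk φ ∈ T.1 → FreeHA.mk ψ ∈ T.1 := by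
    simp only [Set.forall_mem_image, Set.mem_Ioi, mk_mem_theory]
  refine DualPoset.ext_mk fun φ => ?_
  simp only [mk_mem_theory]
  induction φ with
  | var i => rw [mem_val_var, mem_val_var, hc]
  | bot => exact Iff.rfl
  | and φ ψ ih₁ ih₂ => exact and_congr ih₁ ih₂
  | or φ ψ ih₁ ih₂ => exact or_congr ih₁ ih₂
  | imp φ ψ ih₁ ih₂ =>
    rw [val_imp, UpSet.mem_himp_iff, UpSet.mem_himp_iff, ih₁, ih₂, key, key, hs]

/-- If colours increase strictly along the order, there are finitely many theories of points with
a given colour: by induction from the largest colour, there are finitely many theories of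
successors, hence finitely many sets of those. -/
theorem finite_image_theory_colour (hc : StrictMono c) (S : Fin n → Prop) :
    (theory c '' {x | c x = S}).Finite := by
  induction S using WellFoundedGT.induction with
  | ind S ih =>
    have hA : (⋃ T ∈ {T | S < T}, theory c '' {x | c x = T}).Finite :=
      (Set.toFinite _).biUnion fun T hT => ih T hT
    let g : {x // c x = S} → Set (Canonical n) := fun x => theory c '' Set.Ioi x.1
    have hg : (Set.range g).Finite := by
      refine hA.finite_subsets.subset ?_
      rintro _ ⟨x, rfl⟩ _ ⟨y, hy, rfl⟩
      exact Set.mem_biUnion (show S < c y from x.2 ▸ hc hy) ⟨y, rfl, rfl⟩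
    have hfac : Function.FactorsThrough (fun x : {x // c x = S} => theory c x.1) g :=
      fun x y hxy => theory_eq_of_image_Ioi_eq (x.2.trans y.2.symm) hxy
    have := hg.to_subtype
    refine (Set.finite_range fun B : Set.range g => theory c B.2.choose.1).subset ?_
    rintro _ ⟨x, hx, rfl⟩
    exact ⟨⟨g ⟨x, hx⟩, _, rfl⟩, hfac (Exists.choose_spec (p := fun y => g y = g ⟨x, hx⟩) _)⟩

theorem finite_range_theory (hc : StrictMono c) : (Set.range (theory c)).Finite := by
  refine (Set.finite_iUnion (finite_image_theory_colour hc)).subset ?_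
  rintro _ ⟨x, rfl⟩
  exact Set.mem_iUnion.2 ⟨c x, x, rfl, rfl⟩

/-- When only finitely many theories are realised, every prime filter `F` containing the theory of
`x` is the theory of a point above `x`: otherwise some implication true at `x` separates `F` from
the theories of all points above `x`. -/
theorem exists_theory_eq (hfin : (Set.range (theory c)).Finite) {x : X} {F : Canonical n}
    (hF : theory c x ≤ F) : ∃ y, x ≤ y ∧ theory c y = F := by
  by_contra! hne
  have hfin' : (theory c '' Set.Ici x).Finite := hfin.subset (Set.image_subset_range _ _)
  obtain ⟨⟨φ⟩, haF, ⟨ψ⟩, hbF, hab⟩ := DualPoset.exists_separating (F := F) hfin' (by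
    rintro ⟨y, hy, h⟩
    exact hne y hy h)
  have himp : FreeHA.mk (.imp φ ψ) ∈ (theory c x).1 :=
    mk_mem_theory.2 fun y hxy hy => hab _ ⟨y, hxy, rfl⟩ hy
  exact hbF (DualPoset.mem_of_himp_mem (hF himp) haF)

end Theory

/-! ### Separated points -/

section Separated

variable {n : ℕ} {X : Type u} [PartialOrder X] {c : Colouring n X}

/-- Strict successors of a border point of `v(p)` satisfy `p`, so they have a larger colour. -/
theorem strictMono_of_isSeparated (h : ∀ x, IsSeparated c x) : StrictMono c := by
  intro x y hxy
  obtain ⟨i, hi⟩ := h x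
  refine lt_of_le_not_ge (c.monotone hxy.le) fun hle => hi.prop (hle i ?_)
  by_contra hy
  exact hi.not_gt hy hxy

variable (c) in
theorem Sep.isSeparated (x : Sep c) : IsSeparated (Sep.colouring c) x := by
  obtain ⟨i, hi⟩ := x.2
  exact ⟨i, hi.prop, fun y hy hxy => hi.le_of_ge (y := y.1) hy hxy⟩

variable (c) in
/-- The map sending a separated point to its theory, as a p-morphism to the universal model. -/
def Sep.toUniversal : PMorphism (Sep.colouring c) (Universal.colouring n) :=
  have hfin : (Set.range (theory (Sep.colouring c))).Finite :=
    finite_range_theory (strictMono_of_isSeparated (Sep.isSeparated c))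
  { toFun := fun x => ⟨theory (Sep.colouring c) x, hfin.subset fun _ hF =>
      let ⟨y, _, hy⟩ := exists_theory_eq hfin hF
      ⟨y, hy⟩⟩
    monotone' := fun _ _ hxy => theory_mono hxy
    back := fun _ _ hxy =>
      let ⟨y, hy, h⟩ := exists_theory_eq hfin hxy
      ⟨y, hy, Subtype.ext h⟩
    colour := fun _ => rfl }

theorem PMorphism.ext_universal (f g : PMorphism c (Universal.colouring n)) : f = g := by
  have h : f.toOrderHom = g.toOrderHom := by
    ext x : 2
    exact Subtype.ext ((f.coe_eq_theory x).trans (g.coe_eq_theory x).symm)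
  cases f
  cases g
  cases h
  rfl

end Separated

/-! ### The image of a p-morphism -/

namespace PMorphism

variable {n : ℕ} {X : Type u} {Y : Type v} [PartialOrder X] [PartialOrder Y]
  {c : Colouring n X} {d : Colouring n Y} (f : PMorphism c d)

/-- The colouring of the image of a p-morphism induced from the codomain. -/
def imColouring : Colouring n f.Im := d.comp ⟨Subtype.val, fun _ _ h => h⟩

/-- The inclusion of the image of a p-morphism, which is a p-morphism as the image is an
up-set. -/
def imIncl : PMorphism f.imColouring d where
  toFun := Subtype.val
  monotone' _ _ h := h
  back := by
    rintro ⟨_, x, rfl⟩ y hxy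
    obtain ⟨x', -, rfl⟩ := f.back x y hxy
    exact ⟨⟨_, x', rfl⟩, hxy, rfl⟩
  colour _ := rfl

theorem toIm_surjective : Function.Surjective f.toIm := by
  rintro ⟨_, x, rfl⟩
  exact ⟨x, rfl⟩

theorem exists_le_toIm_eq {x : X} {w : f.Im} (h : f.toIm x ≤ w) : ∃ y, x ≤ y ∧ f.toIm y = w :=
  let ⟨y, hxy, hy⟩ := f.back x w.1 h
  ⟨y, hxy, Subtype.ext hy⟩

theorem mem_hMap {U : UpSet f.Im} {x : X} : x ∈ f.hMap U ↔ f.toIm x ∈ U := Iff.rfl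

theorem hMap_inf (U V : UpSet f.Im) : f.hMap (U ⊓ V) = f.hMap U ⊓ f.hMap V := rfl

theorem hMap_himp (U V : UpSet f.Im) : f.hMap (U ⇨ V) = f.hMap U ⇨ f.hMap V := by
  ext x
  change f.toIm x ∈ U ⇨ V ↔ x ∈ f.hMap U ⇨ f.hMap V
  simp only [UpSet.mem_himp, mem_hMap]
  refine ⟨fun h y hxy => h _ (f.toIm.monotone hxy), fun h w hw => ?_⟩
  obtain ⟨y, hxy, rfl⟩ := f.exists_le_toIm_eq hw
  exact h y hxy

theorem hMap_injective : Function.Injective f.hMap := by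
  intro U V h
  refine SetLike.ext (f.toIm_surjective.forall.2 fun x => ?_)
  rw [← mem_hMap, h, mem_hMap]

theorem hMap_val_var (i : Fin n) : f.hMap (val f.imColouring (.var i)) = val c (.var i) := by
  refine SetLike.ext fun x => ?_
  exact iff_of_eq (congrFun (f.colour x) i)

/-- A p-morphism maps border points of `v(p)` to border points of `v(p)` in its image. -/
theorem isSeparated_im (h : ∀ x, IsSeparated c x) (w : f.Im) : IsSeparated f.imColouring w := by
  obtain ⟨x, rfl⟩ := f.toIm_surjective w
  obtain ⟨i, hi⟩ := h x
  have hval (y : X) : f.toIm y ∈ val f.imColouring (.var i) ↔ y ∈ val c (.var i) := by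
    rw [← f.hMap_val_var, mem_hMap]
  refine ⟨i, (hval x).not.2 hi.prop, fun w hw hxw => ?_⟩
  obtain ⟨y, hxy, rfl⟩ := f.exists_le_toIm_eq hxw
  exact f.toIm.monotone (hi.le_of_ge ((hval y).not.1 hw) hxy)

theorem finite_im (f : PMorphism c (Universal.colouring n)) (h : (Set.range (theory c)).Finite) :
    Finite f.Im := by
  refine (Set.Finite.of_finite_image (f := Subtype.val) (h.subset ?_)
    Subtype.val_injective.injOn).to_subtype
  rintro _ ⟨_, ⟨x, rfl⟩, rfl⟩
  exact ⟨x, (f.coe_eq_theory x).symm⟩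

/-- Points of the image in the universal model are their own theories, so they are determined by
their colours and strict successors. -/
theorem im_eq_of_Ioi_eq (f : PMorphism c (Universal.colouring n)) {z w : f.Im}
    (hc : f.imColouring z = f.imColouring w) (hs : Set.Ioi z = Set.Ioi w) : z = w := by
  refine Subtype.ext (Subtype.ext ?_)
  have := theory_eq_of_image_Ioi_eq hc (congrArg (theory f.imColouring '' ·) hs)
  rwa [← f.imIncl.coe_eq_theory, ← f.imIncl.coe_eq_theory] at this

end PMorphism

/-! ### The upper adjoint of the restriction map -/

section Restriction

variable {n : ℕ} {X : Type u} [PartialOrder X] {c : Colouring n X}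

theorem coe_mem_rMap {V : UpSet (Sep c)} {y : Sep c} : y.1 ∈ rMap c V ↔ y ∈ V :=
  ⟨fun h => h y le_rfl, fun h _ hz => V.mem_of_le hz h⟩

theorem rMap_injective : Function.Injective (rMap c) := fun U V h =>
  SetLike.ext fun y => by rw [← coe_mem_rMap, h, coe_mem_rMap]

theorem rMap_inf (U V : UpSet (Sep c)) : rMap c (U ⊓ V) = rMap c U ⊓ rMap c V :=
  (gc_qMap_rMap c).u_inf

theorem rMap_himp (U V : UpSet (Sep c)) : rMap c (U ⇨ V) = rMap c U ⇨ rMap c V := by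
  refine SetLike.ext fun x => ⟨fun h y hxy hy z hyz => ?_, fun h y hxy z hyz hz => ?_⟩
  · exact h z (hxy.trans hyz) z le_rfl (hy z hyz)
  · exact coe_mem_rMap.1 (h z (hxy.trans hyz) (coe_mem_rMap.2 hz))

/-- Having borders means that membership in `v(p)` is detected by the separated points above. -/
theorem rMap_val_var (hc : HasBorders c) (i : Fin n) :
    rMap c (val (Sep.colouring c) (.var i)) = val c (.var i) := by
  refine SetLike.ext fun x => ⟨fun h => ?_, fun h y hxy => (val c (.var i)).mem_of_le hxy h⟩
  by_contra hx
  obtain ⟨y, hxy, hy⟩ := hc i x hx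
  exact hy.prop (h ⟨y, i, hy⟩ hxy)

end Restriction

/-! ### Generation by the variables in finite models -/

section Generation

instance {X : Type u} [PartialOrder X] [Finite X] : Finite (UpSet X) :=
  Finite.of_injective UpSet.carrier fun _ _ => UpSet.ext

/-- The complement of the principal down-set of `w`. -/
def UpSet.notLE {X : Type u} [PartialOrder X] (w : X) : UpSet X :=
  ⟨{y | ¬ y ≤ w}, fun _ _ hxy hx h => hx (hxy.trans h)⟩

theorem Subalg.subset_generate {A : Type u} [HeytingAlgebra A] (S : Set A) :
    S ⊆ (generate S).carrier := fun _ ha _ hB => hB ha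

/-- Subalgebras of up-sets are closed under finite intersections. -/
theorem Subalg.exists_mem_iff_forall {X : Type u} [PartialOrder X] (B : Subalg (UpSet X))
    {S : Set (UpSet X)} (hS : S.Finite) (hSB : S ⊆ B.carrier) :
    ∃ V ∈ B.carrier, ∀ x, x ∈ V ↔ ∀ U ∈ S, x ∈ U := by
  induction S, hS using Set.Finite.induction_on with
  | empty => exact ⟨⊤, B.top_mem, fun x => by simp [UpSet.mem_top]⟩
  | @insert U S _ _ ih =>
    obtain ⟨V, hV, h⟩ := ih ((Set.subset_insert U S).trans hSB)
    refine ⟨U ⊓ V, B.inf_mem (hSB (Set.mem_insert U S)) hV, fun x => ?_⟩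
    rw [UpSet.mem_inf, h, Set.forall_mem_insert]

variable {n : ℕ} {X : Type u} [PartialOrder X] [Finite X] {d : Colouring n X}

/-- In a finite model all of whose points are separated and determined by their colours and strict
successors, complements of principal down-sets belong to the subalgebra generated by the variables.
Let `w` be a border point of `v(p)`, and let `V` be the least member of the subalgebra containing
`w`. Then `w` is the only point of `V` outside `v(p)`, so the complement of `↓w` is `V ⇨ v(p)`. -/
theorem notLE_mem_generate (hsep : ∀ w, IsSeparated d w)
    (hdet : ∀ z w, d z = d w → Set.Ioi z = Set.Ioi w → z = w) (w : X) :
    UpSet.notLE w ∈ (Subalg.generate (Set.range fun i : Fin n => val d (.var i))).carrier := by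
  set B := Subalg.generate (Set.range fun i : Fin n => val d (.var i)) with hB
  have hvar (i : Fin n) : val d (.var i) ∈ B.carrier := Subalg.subset_generate _ ⟨i, rfl⟩
  induction hS : d w using WellFoundedGT.induction generalizing w with
  | ind S ih =>
    subst hS
    have ih' (u : X) (hu : d w < d u) : UpSet.notLE u ∈ B.carrier := ih _ hu u rfl
    obtain ⟨p, hp⟩ := hsep w
    have hsucc {u : X} (hu : w < u) : u ∈ val d (.var p) := by
      by_contra h
      exact hp.not_gt h hu
    obtain ⟨V, hVB, hV⟩ := B.exists_mem_iff_forall (Set.toFinite {U ∈ B.carrier | w ∈ U})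
      fun U hU => hU.1
    -- At `w`, where `p` fails and above which `p` holds, `U ⇨ p` says that `U` fails.
    have hmem {U : UpSet X} (hw : w ∉ U) : w ∈ U ⇨ val d (.var p) :=
      UpSet.mem_himp_iff.2 ⟨fun h => (hw h).elim, fun u hu _ => hsucc hu⟩
    have huniq (z : X) (hzV : z ∈ V) (hzp : z ∉ val d (.var p)) : z = w := by
      have hz {U : UpSet X} (hU : U ∈ B.carrier) : z ∈ U ↔ w ∈ U := by
        refine ⟨fun hzU => ?_, fun hw => (hV z).1 hzV U ⟨hU, hw⟩⟩
        by_contra hw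
        exact hzp ((hV z).1 hzV _ ⟨B.himp_mem hU (hvar p), hmem hw⟩ z le_rfl hzU)
      have hcol : d z = d w := funext fun i => propext (hz (hvar i))
      refine hdet z w hcol (Set.ext fun u => ?_)
      have hlt {a : X} (hau : a < u) : d a < d u := strictMono_of_isSeparated hsep hau
      -- `z` and `w` agree on being below `u`, as the complement of `↓u` is in the subalgebra.
      have hle (hu : d w < d u) : z ≤ u ↔ w ≤ u := not_iff_not.1 (hz (ih' u hu))
      refine ⟨fun hzu => ?_, fun hwu => ?_⟩
      · have hu : d w < d u := hcol ▸ hlt hzu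
        exact ((hle hu).1 (le_of_lt hzu)).lt_of_ne fun h => hu.ne (congrArg d h)
      · have hu : d w < d u := hlt hwu
        exact ((hle hu).2 (le_of_lt hwu)).lt_of_ne fun h => hu.ne (hcol ▸ congrArg d h)
    have heq : UpSet.notLE w = V ⇨ val d (.var p) := by
      refine SetLike.ext fun y => ⟨fun hy z hyz hzV => ?_, fun hy hyw => ?_⟩
      · by_contra hzp
        exact hy (huniq z hzV hzp ▸ hyz)
      · exact hp.prop (hy w hyw ((hV w).2 fun U hU => hU.2))
    exact heq ▸ B.himp_mem hVB (hvar p)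

/-- Every up-set of a finite poset is an intersection of complements of principal down-sets. -/
theorem mem_generate_of_finite (hsep : ∀ w, IsSeparated d w)
    (hdet : ∀ z w, d z = d w → Set.Ioi z = Set.Ioi w → z = w) (U : UpSet X) :
    U ∈ (Subalg.generate (Set.range fun i : Fin n => val d (.var i))).carrier := by
  obtain ⟨V, hV, h⟩ := Subalg.exists_mem_iff_forall _ (Set.toFinite (UpSet.notLE '' {w | w ∉ U}))
    (Set.forall_mem_image.2 fun w _ => notLE_mem_generate hsep hdet w)
  convert hV
  refine SetLike.ext fun x => ?_
  rw [h, Set.forall_mem_image]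
  refine ⟨fun hx w hw hxw => hw (U.mem_of_le hxw hx), fun hx => ?_⟩
  by_contra hxU
  exact hx hxU le_rfl

end Generation

/-! ### Homomorphisms of implicative meet-semilattices -/

section Hom

variable {A : Type u} {A' : Type v} [HeytingAlgebra A] [HeytingAlgebra A'] {e : A → A'}

/-- A map preserving `∧` and `→` sends generated subalgebras to generated subalgebras. -/
theorem Subalg.generate_image (hinf : ∀ a b, e (a ⊓ b) = e a ⊓ e b)
    (himp : ∀ a b, e (a ⇨ b) = e a ⇨ e b) (S : Set A) :
    (generate (e '' S)).carrier = e '' (generate S).carrier := by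
  apply Set.Subset.antisymm
  · intro a ha
    refine ha
      { carrier := e '' (generate S).carrier
        nonempty := (generate S).nonempty.image e
        inf_mem := ?_
        himp_mem := ?_ } (Set.image_mono (subset_generate S))
    · rintro _ _ ⟨a, ha, rfl⟩ ⟨b, hb, rfl⟩
      exact ⟨a ⊓ b, (generate S).inf_mem ha hb, hinf a b⟩
    · rintro _ _ ⟨a, ha, rfl⟩ ⟨b, hb, rfl⟩
      exact ⟨a ⇨ b, (generate S).himp_mem ha hb, himp a b⟩
  · rintro _ ⟨a, ha, rfl⟩
    refine ha
      { carrier := e ⁻¹' (generate (e '' S)).carrier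
        nonempty := ⟨⊤, ?_⟩
        inf_mem := ?_
        himp_mem := ?_ } fun b hb => subset_generate _ (Set.mem_image_of_mem e hb)
    · have h : e ⊤ = ⊤ := by rw [← himp_self (a := (⊤ : A)), himp, himp_self]
      exact Set.mem_preimage.2 (h ▸ top_mem _)
    · intro a b ha hb
      exact Set.mem_preimage.2 (hinf a b ▸ inf_mem _ ha hb)
    · intro a b ha hb
      exact Set.mem_preimage.2 (himp a b ▸ himp_mem _ ha hb)

/-- A subalgebra that is the image of an injective homomorphism is isomorphic to its domain. -/
theorem Subalg.nonempty_iso_of_injective (hinf : ∀ a b, e (a ⊓ b) = e a ⊓ e b)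
    (himp : ∀ a b, e (a ⇨ b) = e a ⇨ e b)
    (he : Function.Injective e) (B : Subalg A')
    (hB : B.carrier = Set.range e) : Nonempty (Iso B.carrier A) := by
  let g : A ≃ B.carrier := (Equiv.ofInjective e he).trans (Equiv.setCongr hB.symm)
  have hg (a : A) : (g a).1 = e a := rfl
  refine ⟨{ g.symm with map_inf' := fun a b => ?_, map_himp' := fun a b => ?_ }⟩
  · refine (Equiv.symm_apply_eq g).2 (Subtype.ext ?_)
    change a.1 ⊓ b.1 = e (g.symm a ⊓ g.symm b)
    rw [hinf, ← hg, ← hg, g.apply_symm_apply, g.apply_symm_apply]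
  · refine (Equiv.symm_apply_eq g).2 (Subtype.ext ?_)
    change a.1 ⇨ b.1 = e (g.symm a ⇨ g.symm b)
    rw [himp, ← hg, ← hg, g.apply_symm_apply, g.apply_symm_apply]

end Hom

end MeetImp

open MeetImp

theorem theorem3p11 (n : ℕ) {M : Type*} [PartialOrder M] (c : Colouring n M)
    (hM : HasBorders c) :
    ∃ f : PMorphism (Sep.colouring c) (Universal.colouring n),
      (∀ g : PMorphism (Sep.colouring c) (Universal.colouring n), g = f) ∧
      (Subalg.generate (Set.range fun i : Fin n => val c (.var i))).carrier =
        Set.range (rMap c ∘ f.hMap) ∧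
      Nonempty (Iso
        (Subalg.generate (Set.range fun i : Fin n => val c (.var i))).carrier
        (UpSet f.Im)) := by
  let f := Sep.toUniversal c
  let e := rMap c ∘ f.hMap
  have hinf (U V) : e (U ⊓ V) = e U ⊓ e V :=
    (congrArg (rMap c) (f.hMap_inf U V)).trans (rMap_inf _ _)
  have himp (U V) : e (U ⇨ V) = e U ⇨ e V :=
    (congrArg (rMap c) (f.hMap_himp U V)).trans (rMap_himp _ _)
  have hinj : Function.Injective e := rMap_injective.comp f.hMap_injective
  have hvar (i : Fin n) : e (val f.imColouring (.var i)) = val c (.var i) :=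
    (congrArg (rMap c) (f.hMap_val_var i)).trans (rMap_val_var hM i)
  have hfin : Finite f.Im :=
    f.finite_im (finite_range_theory (strictMono_of_isSeparated (Sep.isSeparated c)))
  have hgen : (Subalg.generate (Set.range fun i : Fin n => val f.imColouring (.var i))).carrier =
      Set.univ :=
    Set.eq_univ_of_forall (mem_generate_of_finite (f.isSeparated_im (Sep.isSeparated c))
      fun _ _ => f.im_eq_of_Ioi_eq)
  have hrange : (Subalg.generate (Set.range fun i : Fin n => val c (.var i))).carrier =
      Set.range e := by
    rw [← Set.image_univ (f := e), ← hgen, ← Subalg.generate_image hinf himp, ← Set.range_comp]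
    simp only [Function.comp_def, hvar]
  exact ⟨f, fun g => g.ext_universal f, hrange,
    Subalg.nonempty_iso_of_injective hinf himp hinj _ hrange⟩
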